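/- Let $(U,{}')$ be a differentially closed field of characteristic $0$ whose field of constants is $\mathbb{C}$ (for instance a saturated model of $\mathrm{DCF}_0$ with field of constants $\mathbb{C}$). A subset of $U^n$ is Kolchin closed if it is the vanishing set of a finite system of differential polynomials over $U$, and definable if it is a finite Boolean combination of Kolchin closed sets. A definable set is strongly minimal if it is infinite and each of its definable subsets is finite or cofinite in it. Strongly minimal sets $X_1,X_2$ are orthogonal if there is no infinite definable relation $R\subseteq X_1\times X_2$ whose two projections to $X_1$ and $X_2$ are both finite-to-one. Let $P\in\mathbb{C}[z]$ be a polynomial of degree $3$ and let $c\in\mathbb{C}$ be generic over the coefficients of $P$, that is, transcendental over the subfield of $\mathbb{C}$ generated by the coefficients of $P$. Then the equation $z'=P(z)+c$ is orthogonal to the constants: its solution set $\{z\in U : z'=P(z)+c\}$ and the field of constants $\{z\in U: z'=0\}$ are strongly minimal sets, and they are orthogonal. -/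

import Mathlib

namespace DiffField

/-- Differential polynomials over `U` in variables indexed by `ι`: the variable `(i, k)` stands for
the `k`-th derivative of the `i`-th differential indeterminate. -/
abbrev DiffPoly (ι U : Type*) [CommRing U] := MvPolynomial (ι × ℕ) U

section

variable {U : Type*} [Field U] [Differential U] {ι κ : Type*}

/-- The value of a differential polynomial at the point `x` of the affine space `U ^ ι`. -/
noncomputable def DiffPoly.evalAt (p : DiffPoly ι U) (x : ι → U) : U :=
  MvPolynomial.eval (fun v : ι × ℕ => (Differential.deriv : U → U)^[v.2] (x v.1)) p

/-- Kolchin closed sets: vanishing sets of finite systems of differential polynomials,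
with coefficients from `U`. -/
def IsKolchinClosed (S : Set (ι → U)) : Prop :=
  ∃ I : Finset (DiffPoly ι U), S = {x | ∀ p ∈ I, p.evalAt x = 0}

/-- Definable sets (with parameters from `U`): finite Boolean combinations of
Kolchin closed sets. -/
def IsDefinable (S : Set (ι → U)) : Prop :=
  S ∈ BooleanSubalgebra.closure {Z : Set (ι → U) | IsKolchinClosed Z}

/-- A definable set is strongly minimal if it is infinite and each of its definable subsets is
finite or has finite complement in it. -/
def IsStronglyMinimal (X : Set (ι → U)) : Prop :=
  IsDefinable X ∧ X.Infinite ∧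
    ∀ Y : Set (ι → U), IsDefinable Y → Y ⊆ X → Y.Finite ∨ (X \ Y).Finite

/-- There is an infinite definable relation `R ⊆ X₁ × X₂` (points of `U ^ ι × U ^ κ` are written
as points of `U ^ (ι ⊕ κ)`) on which both projections are finite-to-one. -/
def HasFiniteCorrespondence (X₁ : Set (ι → U)) (X₂ : Set (κ → U)) : Prop :=
  ∃ R : Set (ι ⊕ κ → U), IsDefinable R ∧ R.Infinite ∧
    (∀ r ∈ R, r ∘ Sum.inl ∈ X₁ ∧ r ∘ Sum.inr ∈ X₂) ∧
    (∀ x ∈ X₁, {r ∈ R | r ∘ Sum.inl = x}.Finite) ∧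
    (∀ y ∈ X₂, {r ∈ R | r ∘ Sum.inr = y}.Finite)

/-- Orthogonality, a relation between strongly minimal sets: there is no infinite definable
finite-to-finite correspondence between them. -/
def AreOrthogonal (X₁ : Set (ι → U)) (X₂ : Set (κ → U)) : Prop :=
  IsStronglyMinimal X₁ ∧ IsStronglyMinimal X₂ ∧ ¬ HasFiniteCorrespondence X₁ X₂

variable (U)

/-- Differentially closed field (to be used in characteristic zero): for all differential
polynomials `f`, `g` in one differential indeterminate such that `g ≠ 0` and the order of `g` is
smaller than the order of `f` (elements of `U` have order smaller than `0`), there is `a` in `U`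
with `f(a) = 0` and `g(a) ≠ 0`. The order condition says that `f` involves the `n`-th derivative
for some `n` exceeding the order of each derivative that `g` involves. -/
def IsDifferentiallyClosed : Prop :=
  ∀ f g : DiffPoly (Fin 1) U, g ≠ 0 → (∃ v ∈ f.vars, ∀ w ∈ g.vars, w.2 < v.2) →
    ∃ a : Fin 1 → U, f.evalAt a = 0 ∧ g.evalAt a ≠ 0

/-- The constants of `U`, as a subset of the affine line. -/
def constants : Set (Fin 1 → U) := {x | Differential.deriv (x 0) = 0}

variable {U}

/-- The solution set in `U` of the equation `z' = f(z)`, as a subset of the affine line. -/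
def solutions (f : Polynomial U) : Set (Fin 1 → U) := {z | Differential.deriv (z 0) = f.eval (z 0)}

end

end DiffField

/-! Write `f` for the right-hand side. On solutions of `z' = f(z)` and on constants every
differential polynomial reduces to an ordinary polynomial, so a definable set or its complement lies
in a proper algebraic subset. This gives strong minimality. For orthogonality, an infinite
finite-to-finite relation `R` would satisfy some polynomial relation `G(x, y) = 0`. Differentiating
it and eliminating the leading coefficient in `y` lowers the degree, unless the ratios of the
coefficients of `G` are constants of `U(x)`, where `x' = f(x)` (`finite_of_evalEval_eq_zero`).

It remains to see that `U(x)` has no constants outside `k` (`exists_eq_C_mul_of_incommensurable`).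
Expand a constant `g / h` at a zero `a` of `f`. Its coefficients solve linear equations `vₙ' + n
f'(a) vₙ = ...`, so they lie in `k(u)` with `u' = -f'(a) u`, and `g / h` descends to `k(u)`. At a
second zero `b`, the first nonzero coefficient of positive index would be an eigenvector in `k(u)`
with eigenvalue `-n f'(b)`, while the eigenvalues there are integer multiples of `f'(a)`. Hence `g /
h` is constant when `f'(b) / f'(a)` is irrational.

For `f = P + c` with roots `aᵢ`, a rational ratio `f'(a₂) / f'(a₁) = -(a₂ - a₃) / (a₁ - a₃)` would
make `c` algebraic over the coefficients of `P`. -/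

namespace DiffField

open Polynomial
open scoped Differential PowerSeries

/-! ### Derivations of polynomials and power series along the vector field. -/

section TotalDerivative

variable {U : Type*} [Field U] [Differential U]

/-- The derivation of `U[X]` that extends the derivation of `U` and sends `X` to `f`. -/
noncomputable def totalDeriv (f : U[X]) : Derivation ℤ U[X] U[X] :=
  Differential.mapCoeffs + f • (Polynomial.derivative' (R := U)).restrictScalars ℤ

lemma totalDeriv_apply (f g : U[X]) :
    totalDeriv f g = Differential.mapCoeffs g + f * derivative g := rfl

lemma deriv_eval (f g : U[X]) {x : U} (hx : x′ = f.eval x) :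
    (g.eval x)′ = (totalDeriv f g).eval x := by
  have h := Differential.deriv_aeval_eq (A := U) (R := U) x g
  simp only [coe_aeval_eq_eval] at h
  rw [h, totalDeriv_apply, hx, eval_add, eval_mul]; ring

lemma mapCoeffs_taylor (a : U) (ha : a′ = 0) (g : U[X]) :
    Differential.mapCoeffs (taylor a g) = taylor a (Differential.mapCoeffs g) := by
  induction g using Polynomial.induction_on' with
  | add p q hp hq => simp only [map_add, hp, hq]
  | monomial n c =>
    rw [taylor_monomial, Differential.mapCoeffs_monomial, taylor_monomial, Derivation.leibniz,
      Derivation.leibniz_pow]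
    simp [ha, mul_comm]

lemma totalDeriv_taylor (a : U) (ha : a′ = 0) (f g : U[X]) :
    totalDeriv (taylor a f) (taylor a g) = taylor a (totalDeriv f g) := by
  rw [totalDeriv_apply, totalDeriv_apply, mapCoeffs_taylor a ha, map_add, taylor_mul]
  congr 2
  simp [taylor_apply, derivative_comp]

/-- The derivation of `U⟦X⟧` that extends the derivation of `U` and sends `X` to `F`. -/
noncomputable def seriesDeriv (F v : U⟦X⟧) : U⟦X⟧ :=
  PowerSeries.mk (fun n => (PowerSeries.coeff n v)′) + F * PowerSeries.derivative U v

lemma seriesDeriv_coe (f g : U[X]) : seriesDeriv (f : U⟦X⟧) g = (totalDeriv f g : U[X]) := by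
  rw [seriesDeriv, totalDeriv_apply, PowerSeries.derivative_coe, Polynomial.coe_add,
    Polynomial.coe_mul]
  congr 1
  ext n
  simp

lemma seriesDeriv_mul (F v w : U⟦X⟧) :
    seriesDeriv F (v * w) = v * seriesDeriv F w + w * seriesDeriv F v := by
  have h : PowerSeries.mk (fun n => (PowerSeries.coeff n (v * w))′) =
      v * PowerSeries.mk (fun n => (PowerSeries.coeff n w)′) +
      w * PowerSeries.mk (fun n => (PowerSeries.coeff n v)′) := by
    ext n
    simp only [PowerSeries.coeff_mk, map_add, PowerSeries.coeff_mul, map_sum, Derivation.leibniz,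
      smul_eq_mul, Finset.sum_add_distrib]
    congr 1
    exact Finset.Nat.sum_antidiagonal_swap (n := n)
      (f := fun x => PowerSeries.coeff x.1 w * (PowerSeries.coeff x.2 v)′)
  rw [seriesDeriv, h, Derivation.leibniz, seriesDeriv, seriesDeriv, smul_eq_mul, smul_eq_mul]
  ring

lemma seriesDeriv_eq_zero {F g h v : U⟦X⟧} (hh : h ≠ 0) (hv : g = v * h)
    (hgh : g * seriesDeriv F h = h * seriesDeriv F g) : seriesDeriv F v = 0 := by
  have e : h * h * seriesDeriv F v = 0 := by
    rw [hv, seriesDeriv_mul] at hgh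
    linear_combination -hgh
  simpa [hh] using e

/-- Since `F` has no constant term, the `n`-th coefficient of `seriesDeriv F v = 0` is a linear
differential equation for `vₙ` whose other terms involve only `vⱼ` with `1 ≤ j < n`. With `S = ⊥` it
becomes the homogeneous equation. -/
lemma deriv_coeff_add_mem {R : Type*} [CommRing R] [Algebra R U] (S : Submodule R U) {F v : U⟦X⟧}
    (hF0 : PowerSeries.coeff 0 F = 0)
    (hF : ∀ n, PowerSeries.coeff n F ∈ Set.range (algebraMap R U)) (hv : seriesDeriv F v = 0)
    (n : ℕ) (hS : ∀ j, 1 ≤ j → j < n → PowerSeries.coeff j v ∈ S) :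
    (PowerSeries.coeff n v)′ + n * PowerSeries.coeff 1 F * PowerSeries.coeff n v ∈ S := by
  have h := congrArg (PowerSeries.coeff n) hv
  simp only [seriesDeriv, map_add, PowerSeries.coeff_mk, PowerSeries.coeff_mul,
    PowerSeries.coeff_derivative, map_zero] at h
  rcases n with _ | k
  · simp only [Finset.Nat.antidiagonal_zero, Finset.sum_singleton, hF0, zero_mul, add_zero] at h
    rw [h, Nat.cast_zero, zero_mul, zero_mul, add_zero]
    exact S.zero_mem
  -- The pair `(1, k)` is the only one that contributes the top coefficient of `v`.
  · rw [← Finset.add_sum_erase _ _ (a := (1, k)) (by simp [add_comm])] at h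
    have hm : ∑ p ∈ (Finset.HasAntidiagonal.antidiagonal (k + 1)).erase (1, k), PowerSeries.coeff p.1 F *
        (PowerSeries.coeff (p.2 + 1) v * ((p.2 : U) + 1)) ∈ S := by
      refine S.sum_mem fun p hp => ?_
      obtain ⟨i, j⟩ := p
      simp only [Finset.mem_erase, Finset.HasAntidiagonal.mem_antidiagonal, ne_eq, Prod.mk.injEq] at hp
      rcases Nat.eq_zero_or_pos i with rfl | hi
      · simp [hF0]
      · obtain ⟨c, hc⟩ := hF i
        have : PowerSeries.coeff i F * (PowerSeries.coeff (j + 1) v * ((j : U) + 1)) =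
            (c * ((j : R) + 1)) • PowerSeries.coeff (j + 1) v := by
          rw [Algebra.smul_def, ← hc]
          simp only [map_mul, map_add, map_natCast, map_one]
          ring
        rw [this]
        exact S.smul_mem _ (hS _ (by omega) (by omega))
    have : (PowerSeries.coeff (k + 1) v)′ + ((k + 1 : ℕ) : U) * PowerSeries.coeff 1 F *
        PowerSeries.coeff (k + 1) v = -∑ p ∈ (Finset.HasAntidiagonal.antidiagonal (k + 1)).erase (1, k),
        PowerSeries.coeff p.1 F * (PowerSeries.coeff (p.2 + 1) v * ((p.2 : U) + 1)) := by
      push_cast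
      linear_combination h
    rw [this]
    exact S.neg_mem hm

end TotalDerivative

/-! ### Descent of rational functions to a subfield. -/

section Descent

variable {K U : Type*} [Field K] [Field U] [Algebra K U]

lemma exists_polynomial_coeff_eq (φ : U →ₗ[K] K) (g : U[X]) :
    ∃ p : K[X], ∀ i, p.coeff i = φ (g.coeff i) := by
  refine ⟨∑ i ∈ g.support, monomial i (φ (g.coeff i)), fun i => ?_⟩
  simp only [finsetSum_coeff, coeff_monomial, Finset.sum_ite_eq', mem_support_iff]
  split_ifs with h
  · rfl
  · rw [notMem_support_iff.1 h, map_zero]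

/-- A quotient of polynomials whose power series expansion has coefficients in a subfield is a
quotient of polynomials over the subfield. -/
lemma exists_quotient_over_subfield {g h : U[X]} (hh : h ≠ 0) {v : U⟦X⟧} (hv : (g : U⟦X⟧) = v * h)
    (hK : ∀ n, PowerSeries.coeff n v ∈ Set.range (algebraMap K U)) :
    ∃ g₀ h₀ : K[X], h₀ ≠ 0 ∧ g * h₀.map (algebraMap K U) = g₀.map (algebraMap K U) * h := by
  choose w hw using hK
  obtain ⟨n, hn⟩ : ∃ n, h.coeff n ≠ 0 := ⟨h.natDegree, by simpa using hh⟩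
  -- A `K`-linear functional applied coefficientwise commutes with multiplication by `v`, so it
  -- carries `g = v h` to the same relation over `K`.
  obtain ⟨φ, hφ⟩ : ∃ φ : Module.Dual K U, φ (h.coeff n) ≠ 0 := by
    by_contra! H
    exact hn ((Module.forall_dual_apply_eq_zero_iff K _).1 H)
  obtain ⟨g₀, hg₀⟩ := exists_polynomial_coeff_eq φ g
  obtain ⟨h₀, hh₀⟩ := exists_polynomial_coeff_eq φ h
  refine ⟨g₀, h₀, fun h0 => hφ (by rw [← hh₀, h0, coeff_zero]), ?_⟩
  have key : ((g₀.map (algebraMap K U) : U[X]) : U⟦X⟧) =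
      v * ((h₀.map (algebraMap K U) : U[X]) : U⟦X⟧) := by
    ext i
    have e := congrArg (fun s => φ (PowerSeries.coeff i s)) hv
    simp only [PowerSeries.coeff_mul, coeff_coe, map_sum] at e
    simp only [PowerSeries.coeff_mul, coeff_coe, coeff_map, hg₀, e, hh₀, map_sum]
    refine Finset.sum_congr rfl fun p _ => ?_
    rw [← hw, ← Algebra.smul_def, map_smul, smul_eq_mul, map_mul]
  apply Polynomial.coe_injective U
  rw [Polynomial.coe_mul, Polynomial.coe_mul, key, hv]
  ring

/-- Dividing by the lowest nonzero coefficient of `p` determines the coefficients of `v`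
recursively. -/
lemma coeff_mem_of_mul_mem (S : Subfield U) {p q v : U⟦X⟧} (hp0 : p ≠ 0) (h : p * v = q)
    (hp : ∀ n, PowerSeries.coeff n p ∈ S) (hq : ∀ n, PowerSeries.coeff n q ∈ S) (n : ℕ) :
    PowerSeries.coeff n v ∈ S := by
  classical
  have hex : ∃ n, PowerSeries.coeff n p ≠ 0 := by
    by_contra! H
    exact hp0 (PowerSeries.ext (by simpa using H))
  obtain ⟨m, hm, hlt⟩ : ∃ m, PowerSeries.coeff m p ≠ 0 ∧ ∀ i < m, PowerSeries.coeff i p = 0 :=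
    ⟨Nat.find hex, Nat.find_spec hex, fun i hi => not_not.1 (Nat.find_min hex hi)⟩
  induction n using Nat.strong_induction_on with
  | _ n ih =>
    have e := congrArg (PowerSeries.coeff (m + n)) h
    rw [PowerSeries.coeff_mul, ← Finset.add_sum_erase _ _ (a := (m, n)) (by simp)] at e
    have hs : ∑ x ∈ (Finset.HasAntidiagonal.antidiagonal (m + n)).erase (m, n),
        PowerSeries.coeff x.1 p * PowerSeries.coeff x.2 v ∈ S := by
      refine S.sum_mem fun x hx => ?_
      obtain ⟨i, j⟩ := x
      simp only [Finset.mem_erase, Finset.HasAntidiagonal.mem_antidiagonal, ne_eq,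
        Prod.mk.injEq] at hx
      rcases lt_or_ge i m with hi | hi
      · simp [hlt i hi]
      · exact S.mul_mem (hp i) (ih j (by omega))
    have : PowerSeries.coeff n v = (PowerSeries.coeff m p)⁻¹ * (PowerSeries.coeff (m + n) q -
        ∑ x ∈ (Finset.HasAntidiagonal.antidiagonal (m + n)).erase (m, n),
        PowerSeries.coeff x.1 p * PowerSeries.coeff x.2 v) := by
      rw [← e]
      field_simp
      ring
    rw [this]
    exact S.mul_mem (S.inv_mem (hp m)) (S.sub_mem (hq _) hs)

end Descent

/-! ### Linear equations over the constants and eigenvectors in `k(u)`. -/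

section Constants

variable {k U : Type*} [Field k] [Field U] [Differential U] [Algebra k U]

lemma deriv_smul_of_const (hk : ∀ x : U, x′ = 0 ↔ x ∈ Set.range (algebraMap k U)) (c : k) (x : U) :
    (c • x)′ = c • x′ := by
  rw [Algebra.smul_def, Derivation.leibniz, (hk _).2 ⟨c, rfl⟩, smul_eq_mul, smul_zero, add_zero,
    Algebra.smul_def]

lemma mapCoeffs_map_eq_zero (hk : ∀ x : U, x′ = 0 ↔ x ∈ Set.range (algebraMap k U)) (p : k[X]) :
    Differential.mapCoeffs (p.map (algebraMap k U)) = 0 := by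
  ext n
  rw [Differential.coeff_mapCoeffs, coeff_map, (hk _).2 ⟨_, rfl⟩, coeff_zero]

lemma deriv_aeval_of_const (hk : ∀ x : U, x′ = 0 ↔ x ∈ Set.range (algebraMap k U)) (p : k[X])
    (u : U) : (aeval u p)′ = aeval u (derivative p) * u′ := by
  have h := Differential.deriv_aeval_eq (A := U) u (p.map (algebraMap k U))
  rw [mapCoeffs_map_eq_zero hk] at h
  simpa using h

lemma deriv_pow_of_eigen {u : U} {ρ : k} (hu : u′ = -(ρ • u)) (n : ℕ) :
    (u ^ n)′ = -((n * ρ) • u ^ n) := by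
  rcases n with _ | n
  · simp
  · rw [Derivation.leibniz_pow, hu]
    simp only [Nat.add_sub_cancel, nsmul_eq_mul, smul_eq_mul]
    simp only [Algebra.smul_def, map_mul, map_natCast]
    ring

/-- The operator `z ↦ z' + nρz` is diagonal on the powers `u ^ j`, with eigenvalue `(n - j)ρ`,
nonzero for `j < n`. -/
lemma exists_deriv_add_eq [CharZero k] (hk : ∀ x : U, x′ = 0 ↔ x ∈ Set.range (algebraMap k U))
    {u : U} {ρ : k} (hρ : ρ ≠ 0) (hu : u′ = -(ρ • u)) (n : ℕ) {y : U}
    (hy : y ∈ Submodule.span k ((fun j => u ^ j) '' Set.Iio n)) :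
    ∃ z ∈ Submodule.span k ((fun j => u ^ j) '' Set.Iio n), z′ + (n * ρ) • z = y := by
  induction hy using Submodule.span_induction with
  | mem x hx =>
    obtain ⟨j, hj, rfl⟩ := hx
    have hne : (n : k) - j ≠ 0 := by
      rw [sub_ne_zero]
      exact_mod_cast (ne_of_gt hj)
    refine ⟨(((n : k) - j) * ρ)⁻¹ • u ^ j,
      Submodule.smul_mem _ _ (Submodule.subset_span ⟨j, hj, rfl⟩), ?_⟩
    rw [deriv_smul_of_const hk, deriv_pow_of_eigen hu, ← neg_smul, smul_smul, smul_smul,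
      ← add_smul]
    convert one_smul k (u ^ j) using 2
    field_simp
    ring
  | zero => exact ⟨0, Submodule.zero_mem _, by simp⟩
  | add x y _ _ hx hy =>
    obtain ⟨a, ha, rfl⟩ := hx
    obtain ⟨b, hb, rfl⟩ := hy
    exact ⟨a + b, Submodule.add_mem _ ha hb, by rw [map_add, smul_add]; abel⟩
  | smul c x _ hx =>
    obtain ⟨a, ha, rfl⟩ := hx
    exact ⟨c • a, Submodule.smul_mem _ _ ha, by
      rw [deriv_smul_of_const hk, smul_add, smul_comm c]⟩

/-- The quotient `w / u ^ n` of two solutions of the same linear equation is a constant. -/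
lemma exists_eq_smul_pow (hk : ∀ x : U, x′ = 0 ↔ x ∈ Set.range (algebraMap k U)) {u : U} {ρ : k}
    (hu0 : u ≠ 0) (hu : u′ = -(ρ • u)) (n : ℕ) {w : U} (hw : w′ + (n * ρ) • w = 0) :
    ∃ c : k, w = c • u ^ n := by
  have hun : u ^ n ≠ 0 := pow_ne_zero n hu0
  obtain ⟨c, hc⟩ := (hk (w / u ^ n)).1 (by
    have h1 : w = (w / u ^ n) * u ^ n := by field_simp
    have h2 := congrArg Differential.deriv h1
    rw [Derivation.leibniz, deriv_pow_of_eigen hu, eq_neg_of_add_eq_zero_left hw] at h2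
    simp only [smul_eq_mul] at h2
    simp only [Algebra.smul_def] at h2
    have h3 : u ^ n * (w / u ^ n)′ = 0 := by
      have : w / u ^ n * u ^ n = w := h1.symm
      linear_combination -h2 + (algebraMap k U (n * ρ)) * this
    simpa [hun] using h3)
  exact ⟨c, by rw [Algebra.smul_def, hc]; field_simp⟩

/-- The power series constants at a zero of the vector field have their coefficients in the
field generated by a solution of the linearized equation. -/
lemma coeff_mem_span [CharZero k] (hk : ∀ x : U, x′ = 0 ↔ x ∈ Set.range (algebraMap k U))
    {u : U} {ρ : k} (hρ : ρ ≠ 0) (hu0 : u ≠ 0) (hu : u′ = -(ρ • u)) {F v : U⟦X⟧}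
    (hF0 : PowerSeries.coeff 0 F = 0) (hF1 : PowerSeries.coeff 1 F = algebraMap k U ρ)
    (hF : ∀ n, PowerSeries.coeff n F ∈ Set.range (algebraMap k U)) (hv : seriesDeriv F v = 0)
    (n : ℕ) :
    PowerSeries.coeff n v ∈ Submodule.span k ((fun j => u ^ j) '' Set.Iio (n + 1)) := by
  induction n using Nat.strong_induction_on with
  | _ n ih =>
    have hy := deriv_coeff_add_mem (Submodule.span k ((fun j => u ^ j) '' Set.Iio n)) hF0 hF hv n
      fun j _ hj => Submodule.span_mono (Set.image_mono (Set.Iio_subset_Iio hj)) (ih j hj)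
    -- A particular solution in the span of lower powers; the homogeneous part adds a multiple of `u
    -- ^ n`.
    obtain ⟨z, hz, e⟩ := exists_deriv_add_eq hk hρ hu n hy
    obtain ⟨c, hc⟩ := exists_eq_smul_pow hk hu0 hu n (w := PowerSeries.coeff n v - z) (by
      rw [hF1] at e
      simp only [Algebra.smul_def, map_mul, map_natCast, map_sub] at e ⊢
      linear_combination -e)
    rw [sub_eq_iff_eq_add.1 hc]
    exact Submodule.add_mem _ (Submodule.smul_mem _ _ (Submodule.subset_span ⟨n, by simp, rfl⟩))
      (Submodule.span_mono (Set.image_mono (Set.Iio_subset_Iio (Nat.le_succ n))) hz)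

/-- An algebraic `u` would lie in the algebraically closed field `k`, giving `u' = 0`. -/
lemma transcendental_of_eigen [IsAlgClosed k]
    (hk : ∀ x : U, x′ = 0 ↔ x ∈ Set.range (algebraMap k U))
    {u : U} {ρ : k} (hρ : ρ ≠ 0) (hu0 : u ≠ 0) (hu : u′ = -(ρ • u)) : Transcendental k u := by
  intro h
  have h1 := minpoly.mem_range_of_degree_eq_one k u
    (IsAlgClosed.degree_eq_one_of_irreducible k (minpoly.irreducible h.isIntegral))
  have h2 := (hk u).2 h1
  rw [hu, neg_eq_zero, smul_eq_zero] at h2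
  tauto

/-- The eigenvalues of the derivation on `k(u)`, for `u` an eigenvector with eigenvalue `-ρ`, are
the integer multiples of `ρ`. -/
lemma eigenvalue_eq_int_mul [IsAlgClosed k]
    (hk : ∀ x : U, x′ = 0 ↔ x ∈ Set.range (algebraMap k U))
    {u : U} {ρ : k} (hρ : ρ ≠ 0) (hu0 : u ≠ 0) (hu : u′ = -(ρ • u)) {w : U} {σ : k} (hw0 : w ≠ 0)
    (hw : w′ + σ • w = 0) (hwu : w ∈ IntermediateField.adjoin k {u}) : ∃ n : ℤ, σ = n * ρ := by
  obtain ⟨A, B, rfl⟩ := (IntermediateField.mem_adjoin_simple_iff k w).1 hwu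
  have hB : aeval u B ≠ 0 := fun h => hw0 (by rw [h, div_zero])
  have hA : aeval u A ≠ 0 := fun h => hw0 (by rw [h, zero_div])
  have hA0 : A ≠ 0 := fun h => hA (by rw [h, map_zero])
  have hB0 : B ≠ 0 := fun h => hB (by rw [h, map_zero])
  have e : aeval u (C ρ * (X * derivative A * B - A * (X * derivative B)) - C σ * (A * B)) = 0 := by
    have h1 : aeval u A / aeval u B * aeval u B = aeval u A := by field_simp
    have h2 := congrArg Differential.deriv h1
    rw [Derivation.leibniz, deriv_aeval_of_const hk, deriv_aeval_of_const hk, hu,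
      eq_neg_of_add_eq_zero_left hw] at h2
    simp only [smul_eq_mul] at h2
    simp only [Algebra.smul_def] at h2
    simp only [map_sub, map_mul, aeval_C, aeval_X]
    field_simp at h2
    linear_combination h2
  have e' := (transcendental_iff.1 (transcendental_of_eigen hk hρ hu0 hu)) _ e
  -- By transcendence of `u` this is an identity of polynomials; its top coefficient gives `σ = (deg
  -- A - deg B) ρ`.
  have e2 := congrArg (fun p => coeff p (A.natDegree + B.natDegree)) e'
  have hX : ∀ p : k[X], (X * derivative p).natDegree ≤ p.natDegree := fun p => by
    rcases eq_or_ne p.natDegree 0 with h | h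
    · rw [eq_C_of_natDegree_eq_zero h]; simp
    · refine natDegree_mul_le.trans ?_
      have := natDegree_derivative_lt h
      rw [natDegree_X]; omega
  have hc : ∀ p : k[X], (X * derivative p).coeff p.natDegree = p.natDegree * p.leadingCoeff :=
    fun p => by
      rcases h : p.natDegree with _ | n
      · simp
      · rw [coeff_X_mul, coeff_derivative, ← h, leadingCoeff, h]; push_cast; ring
  simp only [coeff_sub, coeff_C_mul, coeff_zero, coeff_mul_add_eq_of_natDegree_le (hX A) (le_refl B.natDegree),
    coeff_mul_add_eq_of_natDegree_le (le_refl A.natDegree) (hX B), coeff_mul_degree_add_degree, hc] at e2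
  have hl : A.leadingCoeff * B.leadingCoeff ≠ 0 := by simp [hA0, hB0]
  refine ⟨A.natDegree - B.natDegree, mul_right_cancel₀ hl ?_⟩
  push_cast
  simp only [leadingCoeff] at e2 ⊢
  linear_combination -e2

end Constants

/-! ### No new constants in the rational function field. -/

section NewConstants

variable {k U : Type*} [Field k] [Field U] [Differential U] [Algebra k U]

lemma exists_expansion_at (hk : ∀ x : U, x′ = 0 ↔ x ∈ Set.range (algebraMap k U)) (f : k[X]) (a : k)
    {g h : U[X]} (ha : h.eval (algebraMap k U a) ≠ 0)
    (hgh : g * totalDeriv (f.map (algebraMap k U)) h =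
      h * totalDeriv (f.map (algebraMap k U)) g) :
    ∃ v : U⟦X⟧, ((taylor (algebraMap k U a) g : U[X]) : U⟦X⟧) =
        v * ((taylor (algebraMap k U a) h : U[X]) : U⟦X⟧) ∧
      seriesDeriv (((taylor a f).map (algebraMap k U) : U[X]) : U⟦X⟧) v = 0 := by
  have hc : PowerSeries.constantCoeff ((taylor (algebraMap k U a) h : U[X]) : U⟦X⟧) ≠ 0 := by
    rw [← PowerSeries.coeff_zero_eq_constantCoeff_apply, coeff_coe, taylor_coeff_zero]
    exact ha
  have h0 : ((taylor (algebraMap k U a) h : U[X]) : U⟦X⟧) ≠ 0 := fun h => hc (by simp [h])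
  have hv : ((taylor (algebraMap k U a) g : U[X]) : U⟦X⟧) =
      ((taylor (algebraMap k U a) g : U[X]) : U⟦X⟧) *
      ((taylor (algebraMap k U a) h : U[X]) : U⟦X⟧)⁻¹ *
        ((taylor (algebraMap k U a) h : U[X]) : U⟦X⟧) := by
    rw [mul_assoc, PowerSeries.inv_mul_cancel _ hc, mul_one]
  refine ⟨_, hv, seriesDeriv_eq_zero h0 hv ?_⟩
  rw [seriesDeriv_coe, seriesDeriv_coe, ← Polynomial.coe_mul, ← Polynomial.coe_mul, map_taylor,
    totalDeriv_taylor _ ((hk _).2 ⟨a, rfl⟩), totalDeriv_taylor _ ((hk _).2 ⟨a, rfl⟩),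
    ← taylor_mul, ← taylor_mul, hgh]

/-- The expansion at `a` has coefficients in `k(u)`, so the translated quotient descends;
translating back by `-a` stays over `k(u)`. -/
lemma exists_quotient_over_adjoin [CharZero k]
    (hk : ∀ x : U, x′ = 0 ↔ x ∈ Set.range (algebraMap k U)) {f : k[X]} {a : k} (hfa : f.eval a = 0)
    (hfa' : (derivative f).eval a ≠ 0) {u : U} (hu0 : u ≠ 0)
    (hu : u′ = -((derivative f).eval a • u)) {g h : U[X]} (ha : h.eval (algebraMap k U a) ≠ 0)
    (hgh : g * totalDeriv (f.map (algebraMap k U)) h =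
      h * totalDeriv (f.map (algebraMap k U)) g) :
    ∃ g₀ h₀ : (IntermediateField.adjoin k {u})[X], h₀ ≠ 0 ∧
      g * h₀.map (algebraMap _ U) = g₀.map (algebraMap _ U) * h := by
  obtain ⟨v, hv, hDv⟩ := exists_expansion_at hk f a ha hgh
  have hh : taylor (algebraMap k U a) h ≠ 0 := by
    rw [Ne, taylor_eq_zero]
    rintro rfl
    simp at ha
  have hmem : Submodule.span k ((fun j => u ^ j) '' Set.univ) ≤
      Subalgebra.toSubmodule (IntermediateField.adjoin k {u}).toSubalgebra := by
    rw [Submodule.span_le]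
    rintro _ ⟨j, -, rfl⟩
    exact pow_mem (IntermediateField.mem_adjoin_simple_self k u) j
  obtain ⟨g₁, h₁, h₁0, e⟩ := exists_quotient_over_subfield
    (K := IntermediateField.adjoin k {u}) hh hv fun n => by
      have := coeff_mem_span hk hfa' hu0 hu (F := (((taylor a f).map (algebraMap k U) : U[X]) : U⟦X⟧))
        (by rw [coeff_coe, coeff_map, taylor_coeff_zero, hfa, map_zero])
        (by rw [coeff_coe, coeff_map, taylor_coeff_one])
        (fun n => ⟨_, by rw [coeff_coe, coeff_map]⟩) hDv n
      exact ⟨⟨_, hmem (Submodule.span_mono (Set.image_mono (Set.subset_univ _)) this)⟩, rfl⟩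
  refine ⟨taylor (algebraMap k _ (-a)) g₁, taylor (algebraMap k _ (-a)) h₁, ?_, ?_⟩
  · rwa [Ne, taylor_eq_zero]
  · have e' := congrArg (taylor (algebraMap k U (-a))) e
    rw [taylor_mul, taylor_mul, taylor_taylor, taylor_taylor, ← map_add, neg_add_cancel, map_zero,
      taylor_zero, taylor_zero] at e'
    rw [map_taylor, map_taylor, ← IsScalarTower.algebraMap_apply]
    exact e'

/-- The expansion at `b` also has coefficients in `k(u)`. Its first nonzero coefficient of positive
index would be an eigenvector there, which `hind` excludes. -/
lemma exists_eq_C_mul_of_quotient_over_adjoin [CharZero k] [IsAlgClosed k]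
    (hk : ∀ x : U, x′ = 0 ↔ x ∈ Set.range (algebraMap k U)) {f : k[X]} {b : k} {ρ : k}
    (hρ : ρ ≠ 0) (hfb : f.eval b = 0)
    (hind : ∀ n : ℕ, n ≠ 0 → ∀ m : ℤ, n * (derivative f).eval b ≠ m * ρ) {u : U} (hu0 : u ≠ 0)
    (hu : u′ = -(ρ • u)) {g h : U[X]} (hb : h.eval (algebraMap k U b) ≠ 0)
    (hgh : g * totalDeriv (f.map (algebraMap k U)) h =
      h * totalDeriv (f.map (algebraMap k U)) g)
    {g₀ h₀ : (IntermediateField.adjoin k {u})[X]} (hh₀ : h₀ ≠ 0)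
    (h0 : g * h₀.map (algebraMap _ U) = g₀.map (algebraMap _ U) * h) :
    ∃ c : k, g = C (algebraMap k U c) * h := by
  classical
  obtain ⟨v, hv, hDv⟩ := exists_expansion_at hk f b hb hgh
  have hF0 : PowerSeries.coeff 0 (((taylor b f).map (algebraMap k U) : U[X]) : U⟦X⟧) = 0 := by
    rw [coeff_coe, coeff_map, taylor_coeff_zero, hfb, map_zero]
  have hF1 : PowerSeries.coeff 1 (((taylor b f).map (algebraMap k U) : U[X]) : U⟦X⟧) =
      algebraMap k U ((derivative f).eval b) := by
    rw [coeff_coe, coeff_map, taylor_coeff_one]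
  have hF : ∀ n, PowerSeries.coeff n (((taylor b f).map (algebraMap k U) : U[X]) : U⟦X⟧) ∈
      Set.range (algebraMap k U) := fun n => ⟨_, by rw [coeff_coe, coeff_map]⟩
  have hh : ((taylor (algebraMap k U b) h : U[X]) : U⟦X⟧) ≠ 0 := by
    rw [Ne, Polynomial.coe_eq_zero_iff, taylor_eq_zero]
    rintro rfl
    simp at hb
  have hvmem : ∀ n, PowerSeries.coeff n v ∈ (IntermediateField.adjoin k {u}).toSubfield := by
    have hT : ∀ p : (IntermediateField.adjoin k {u})[X], ∀ n,
        PowerSeries.coeff n ((taylor (algebraMap k U b) (p.map (algebraMap _ U)) : U[X]) : U⟦X⟧) ∈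
          (IntermediateField.adjoin k {u}).toSubfield := fun p n => by
      rw [IsScalarTower.algebraMap_apply k (IntermediateField.adjoin k {u}) U b, ← map_taylor,
        coeff_coe, coeff_map]
      exact Subtype.prop _
    refine coeff_mem_of_mul_mem _ ?_ ?_ (hT h₀) (hT g₀)
    · rw [Ne, Polynomial.coe_eq_zero_iff, taylor_eq_zero, Polynomial.map_eq_zero]
      exact hh₀
    · apply mul_right_cancel₀ hh
      rw [mul_assoc, ← hv, ← Polynomial.coe_mul, ← Polynomial.coe_mul, ← taylor_mul, ← taylor_mul,
        mul_comm _ g, h0]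
  have hcoeff : ∀ n, n ≠ 0 → PowerSeries.coeff n v = 0 := by
    intro n
    induction n using Nat.strong_induction_on with
    | _ n ih =>
      intro hn
      by_contra hne
      have := deriv_coeff_add_mem (⊥ : Submodule k U) hF0 hF hDv n fun j hj hjn =>
        (Submodule.mem_bot k).2 (ih j hjn (by omega))
      rw [Submodule.mem_bot, hF1] at this
      obtain ⟨m, hm⟩ := eigenvalue_eq_int_mul hk hρ hu0 hu (σ := n * (derivative f).eval b) hne
        (by rw [Algebra.smul_def, map_mul, map_natCast]; exact this) (hvmem n)
      exact hind n hn m hm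
  have h00 := deriv_coeff_add_mem (⊥ : Submodule k U) hF0 hF hDv 0 (by omega)
  rw [Submodule.mem_bot, Nat.cast_zero, zero_mul, zero_mul, add_zero, hk] at h00
  obtain ⟨c, hc⟩ := h00
  refine ⟨c, taylor_injective (algebraMap k U b) (Polynomial.coe_injective U ?_)⟩
  rw [hv, taylor_mul, taylor_C, Polynomial.coe_mul, Polynomial.coe_C]
  congr 1
  ext n
  rcases eq_or_ne n 0 with rfl | hn
  · rw [hc]; simp
  · rw [hcoeff n hn, PowerSeries.coeff_C, if_neg hn]

/-- If the residues of `1 / f` at two simple zeros of `f` are rationally independent, then the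
equation `z' = f(z)` has no new constants in the rational function field. -/
theorem exists_eq_C_mul_of_incommensurable [CharZero k] [IsAlgClosed k]
    (hk : ∀ x : U, x′ = 0 ↔ x ∈ Set.range (algebraMap k U))
    (hex : ∀ ρ : k, ∃ u : U, u ≠ 0 ∧ u′ = -(ρ • u)) {f : k[X]} {a b : k}
    (hfa : f.eval a = 0) (hfb : f.eval b = 0) (hfa' : (derivative f).eval a ≠ 0)
    (hind : ∀ n : ℕ, n ≠ 0 → ∀ m : ℤ,
      n * (derivative f).eval b ≠ m * (derivative f).eval a)
    {g h : U[X]} (hh : h ≠ 0)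
    (hgh : g * totalDeriv (f.map (algebraMap k U)) h =
      h * totalDeriv (f.map (algebraMap k U)) g) :
    ∃ c : k, g = C (algebraMap k U c) * h := by
  classical
  rcases eq_or_ne g 0 with rfl | hg
  · exact ⟨0, by simp⟩
  obtain ⟨u, hu0, hu⟩ := hex ((derivative f).eval a)
  -- For coprime `g`, `h`, at each of `a`, `b` one of `g / h` and `h / g` can be expanded, and the
  -- claim is symmetric in the two.
  suffices H : ∀ g h : U[X], g ≠ 0 → h ≠ 0 → IsCoprime g h →
      g * totalDeriv (f.map (algebraMap k U)) h = h * totalDeriv (f.map (algebraMap k U)) g →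
      ∃ c : k, g = C (algebraMap k U c) * h by
    obtain ⟨g₁, hg₁⟩ := EuclideanDomain.gcd_dvd_left g h
    obtain ⟨h₁, hh₁⟩ := EuclideanDomain.gcd_dvd_right g h
    set d := EuclideanDomain.gcd g h with hd
    have hd0 : d ≠ 0 := fun h0 => hg (by rw [hg₁, h0, zero_mul])
    obtain ⟨c, hc⟩ := H g₁ h₁ (fun h0 => hg (by rw [hg₁, h0, mul_zero]))
      (fun h0 => hh (by rw [hh₁, h0, mul_zero]))
      (by
        have e := EuclideanDomain.gcd_eq_gcd_ab g h
        rw [← hd] at e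
        refine ⟨EuclideanDomain.gcdA g h, EuclideanDomain.gcdB g h, mul_left_cancel₀ hd0 ?_⟩
        linear_combination -e - EuclideanDomain.gcdA g h * hg₁ - EuclideanDomain.gcdB g h * hh₁)
      (by
        rw [hg₁, hh₁, Derivation.leibniz, Derivation.leibniz] at hgh
        simp only [smul_eq_mul] at hgh
        refine mul_left_cancel₀ (mul_ne_zero hd0 hd0) ?_
        linear_combination hgh)
    exact ⟨c, by linear_combination hg₁ + d * hc - C (algebraMap k U c) * hh₁⟩
  intro g h hg hh hco hgh
  have hinv : ∀ {g h : U[X]}, g ≠ 0 → (∃ c : k, g = C (algebraMap k U c) * h) →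
      ∃ c : k, h = C (algebraMap k U c) * g := by
    rintro g h hg ⟨c, rfl⟩
    have hc : c ≠ 0 := by
      rintro rfl
      simp at hg
    refine ⟨c⁻¹, ?_⟩
    rw [← mul_assoc, ← C_mul, ← map_mul, inv_mul_cancel₀ hc, map_one, C_1, one_mul]
  have hne : ∀ x : U, h.eval x ≠ 0 ∨ g.eval x ≠ 0 := by
    intro x
    by_contra! H
    obtain ⟨p, q, e⟩ := hco
    simpa [H.1, H.2] using congrArg (eval x) e
  obtain ⟨g₀, h₀, hg₀, hh₀, e⟩ : ∃ g₀ h₀ : (IntermediateField.adjoin k {u})[X], g₀ ≠ 0 ∧ h₀ ≠ 0 ∧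
      g * h₀.map (algebraMap _ U) = g₀.map (algebraMap _ U) * h := by
    have aux : ∀ {g h : U[X]} {g₀ h₀ : (IntermediateField.adjoin k {u})[X]}, g ≠ 0 → h₀ ≠ 0 →
        g * h₀.map (algebraMap _ U) = g₀.map (algebraMap _ U) * h → g₀ ≠ 0 := by
      rintro g h g₀ h₀ hg hh₀ e rfl
      rw [Polynomial.map_zero, zero_mul, mul_eq_zero,
        Polynomial.map_eq_zero] at e
      tauto
    rcases hne (algebraMap k U a) with ha | ha
    · obtain ⟨g₀, h₀, hh₀, e⟩ := exists_quotient_over_adjoin hk hfa hfa' hu0 hu ha hgh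
      exact ⟨g₀, h₀, aux hg hh₀ e, hh₀, e⟩
    · obtain ⟨h₀, g₀, hg₀, e⟩ := exists_quotient_over_adjoin hk hfa hfa' hu0 hu ha hgh.symm
      exact ⟨g₀, h₀, hg₀, aux hh hg₀ e, by linear_combination -e⟩
  rcases hne (algebraMap k U b) with hb | hb
  · exact exists_eq_C_mul_of_quotient_over_adjoin hk hfa' hfb hind hu0 hu hb hgh hh₀ e
  · exact hinv hh (exists_eq_C_mul_of_quotient_over_adjoin hk hfa' hfb hind hu0 hu hb hgh.symm
      (g₀ := h₀) hg₀ (by linear_combination -e))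

end NewConstants

/-! ### Definable sets seen through ordinary polynomials. -/

section Definable

variable {U : Type*} [Field U] [Differential U] {ι : Type*}

lemma exists_iterate_deriv_eq_eval (f : U[X]) (n : ℕ) :
    ∃ q : U[X], ∀ x : U, x′ = f.eval x → (Differential.deriv : U → U)^[n] x = q.eval x := by
  induction n with
  | zero => exact ⟨X, fun x _ => by simp⟩
  | succ n ih =>
    obtain ⟨q, hq⟩ := ih
    exact ⟨totalDeriv f q, fun x hx => by
      rw [Function.iterate_succ_apply', hq x hx, deriv_eval f q hx]⟩

lemma exists_evalAt_eq {A : Type*} [CommRing A] {X : Set (ι → U)} (ev : (ι → U) → A →+* U)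
    (hC : ∀ c : U, ∃ q, ∀ x ∈ X, c = ev x q)
    (hX : ∀ i n, ∃ q, ∀ x ∈ X, (Differential.deriv : U → U)^[n] (x i) = ev x q)
    (p : DiffPoly ι U) : ∃ q, ∀ x ∈ X, p.evalAt x = ev x q := by
  induction p using MvPolynomial.induction_on with
  | C c =>
    obtain ⟨q, hq⟩ := hC c
    exact ⟨q, fun x hx => by rw [DiffPoly.evalAt, MvPolynomial.eval_C]; exact hq x hx⟩
  | add p₁ p₂ h₁ h₂ =>
    obtain ⟨q₁, h₁⟩ := h₁
    obtain ⟨q₂, h₂⟩ := h₂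
    exact ⟨q₁ + q₂, fun x hx => by rw [map_add, ← h₁ x hx, ← h₂ x hx]; exact map_add _ _ _⟩
  | mul_X p₁ v h₁ =>
    obtain ⟨q₁, h₁⟩ := h₁
    obtain ⟨q₂, h₂⟩ := hX v.1 v.2
    refine ⟨q₁ * q₂, fun x hx => ?_⟩
    rw [map_mul, ← h₁ x hx, ← h₂ x hx, DiffPoly.evalAt, map_mul, MvPolynomial.eval_X,
      DiffPoly.evalAt]

/-- If differential polynomials restrict to functions from the domain `A` on `X`, then a definable
set or its complement is contained in a proper closed subset of `X`. -/
lemma IsDefinable.exists_ne_zero {A : Type*} [CommRing A] [IsDomain A] {X : Set (ι → U)}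
    (ev : (ι → U) → A →+* U) (hev : ∀ p : DiffPoly ι U, ∃ q, ∀ x ∈ X, p.evalAt x = ev x q)
    {Z : Set (ι → U)} (hZ : IsDefinable Z) :
    ∃ q : A, q ≠ 0 ∧ ((∀ x ∈ X, x ∈ Z → ev x q = 0) ∨ ∀ x ∈ X, x ∉ Z → ev x q = 0) := by
  induction hZ using BooleanSubalgebra.closure_bot_sup_induction with
  | mem Z hZ =>
    obtain ⟨I, rfl⟩ := hZ
    choose r hr using hev
    by_cases h : ∃ p ∈ I, r p ≠ 0
    · obtain ⟨p, hp, hp0⟩ := h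
      exact ⟨r p, hp0, Or.inl fun x hx hxZ => by rw [← hr p x hx]; exact hxZ p hp⟩
    · push Not at h
      -- All equations vanish on `X`, so `X` lies in the closed set and its complement in `X` is
      -- empty.
      refine ⟨1, one_ne_zero, Or.inr fun x hx hxZ => (hxZ fun p hp => ?_).elim⟩
      rw [hr p x hx, h p hp, map_zero]
  | bot => exact ⟨1, one_ne_zero, Or.inl fun x _ hx => hx.elim⟩
  | sup Y _ Z _ hY hZ =>
    obtain ⟨p, hp, hY⟩ := hY
    obtain ⟨q, hq, hZ⟩ := hZ
    refine ⟨p * q, mul_ne_zero hp hq, ?_⟩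
    rcases hY with hY | hY
    · rcases hZ with hZ | hZ
      · refine Or.inl fun x hx hxYZ => ?_
        rcases hxYZ with h | h
        · rw [map_mul, hY x hx h, zero_mul]
        · rw [map_mul, hZ x hx h, mul_zero]
      · exact Or.inr fun x hx h => by rw [map_mul, hZ x hx fun h' => h (Or.inr h'), mul_zero]
    · exact Or.inr fun x hx h => by rw [map_mul, hY x hx fun h' => h (Or.inl h'), zero_mul]
  | compl Z _ hZ =>
    obtain ⟨q, hq, hZ⟩ := hZ
    exact ⟨q, hq, hZ.symm.imp (fun h x hx hxZ => h x hx hxZ)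
      fun h x hx hxZ => h x hx (not_not.1 hxZ)⟩

end Definable

/-! ### Polynomials in a single variable of a polynomial ring. -/

section Polynomials

variable {U : Type*} [Field U]

lemma aeval_X_ne_zero {σ : Type*} (v : σ) {r : U[X]} (hr : r ≠ 0) :
    aeval (MvPolynomial.X v : MvPolynomial σ U) r ≠ 0 := by
  intro h
  have := congrArg (MvPolynomial.aeval fun _ => (X : U[X])) h
  rw [← aeval_algHom_apply, MvPolynomial.aeval_X, aeval_X_left_apply, map_zero] at this
  exact hr this

lemma vars_aeval_X_subset {σ : Type*} (v : σ) (r : U[X]) {w : σ}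
    (hw : w ∈ (aeval (MvPolynomial.X v : MvPolynomial σ U) r).vars) : w = v := by
  have h : aeval (MvPolynomial.X v : MvPolynomial σ U) r ∈ MvPolynomial.supported U {v} := by
    rw [MvPolynomial.supported, Set.image_singleton]
    exact aeval_mem_adjoin_singleton U _
  exact MvPolynomial.mem_supported.1 h hw

lemma finite_eval_eq_zero {r : U[X]} (hr : r ≠ 0) : {x : Fin 1 → U | r.eval (x 0) = 0}.Finite := by
  refine Set.Finite.of_finite_image (f := fun x : Fin 1 → U => x 0)
    ((r.rootSet_finite U).subset ?_) fun x _ y _ h => funext fun i => by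
      rw [Subsingleton.elim i 0]; exact h
  rintro _ ⟨x, hx, rfl⟩
  rw [mem_rootSet]
  exact ⟨hr, by simpa using hx⟩

end Polynomials

/-! ### Strong minimality of first-order autonomous equations. -/

section StronglyMinimal

variable {U : Type*} [Field U] [Differential U]

lemma evalAt_aeval_X (i : Fin 1) (r : U[X]) (x : Fin 1 → U) :
    DiffPoly.evalAt (aeval (MvPolynomial.X (i, 0)) r : DiffPoly (Fin 1) U) x = r.eval (x i) := by
  rw [DiffPoly.evalAt, ← MvPolynomial.coe_aeval_eq_eval, RingHom.coe_coe, ← aeval_algHom_apply,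
    MvPolynomial.aeval_X, Function.iterate_zero, id, coe_aeval_eq_eval]

lemma evalAt_X_one_sub (f : U[X]) (x : Fin 1 → U) :
    DiffPoly.evalAt (MvPolynomial.X (0, 1) - aeval (MvPolynomial.X (0, 0)) f : DiffPoly (Fin 1) U)
      x = (x 0)′ - f.eval (x 0) := by
  rw [← evalAt_aeval_X 0, DiffPoly.evalAt, map_sub, MvPolynomial.eval_X]
  rfl

lemma IsDifferentiallyClosed.exists_solution (hU : IsDifferentiallyClosed U) (f : U[X]) {r : U[X]}
    (hr : r ≠ 0) : ∃ z : U, z′ = f.eval z ∧ r.eval z ≠ 0 := by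
  obtain ⟨a, ha, ha'⟩ := hU (MvPolynomial.X (0, 1) - aeval (MvPolynomial.X (0, 0)) f)
    (aeval (MvPolynomial.X (0, 0)) r) (aeval_X_ne_zero _ hr) ⟨(0, 1), by
      by_contra h
      -- The partial derivative of `z' - f(z)` with respect to `z'` is `1`, so `z'` does occur.
      have h1 := MvPolynomial.pderiv_eq_zero_of_notMem_vars h
      have h2 : MvPolynomial.pderiv (0, 1)
          (aeval (MvPolynomial.X (0, 0)) f : DiffPoly (Fin 1) U) = 0 := by
        refine MvPolynomial.pderiv_eq_zero_of_notMem_vars fun h => ?_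
        simpa using vars_aeval_X_subset _ _ h
      rw [map_sub, h2, sub_zero, MvPolynomial.pderiv_X_self] at h1
      exact one_ne_zero h1, fun w hw => by rw [vars_aeval_X_subset _ _ hw]; exact one_pos⟩
  rw [evalAt_X_one_sub] at ha
  rw [evalAt_aeval_X] at ha'
  exact ⟨a 0, sub_eq_zero.1 ha, ha'⟩

lemma infinite_solutions (hU : IsDifferentiallyClosed U) (f : U[X]) : (solutions f).Infinite := by
  intro hfin
  obtain ⟨z, hz, hz'⟩ := hU.exists_solution f (r := ∏ x ∈ hfin.toFinset, (X - C (x 0)))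
    (Finset.prod_ne_zero_iff.2 fun x _ => X_sub_C_ne_zero _)
  refine hz' ?_
  rw [eval_prod]
  exact Finset.prod_eq_zero (i := fun _ => z) (hfin.mem_toFinset.2 hz) (by simp)

theorem isStronglyMinimal_solutions (hU : IsDifferentiallyClosed U) (f : U[X]) :
    IsStronglyMinimal (solutions f) := by
  refine ⟨BooleanSubalgebra.subset_closure
    ⟨{MvPolynomial.X (0, 1) - aeval (MvPolynomial.X (0, 0)) f}, ?_⟩, infinite_solutions hU f, ?_⟩
  · ext x
    rw [Set.mem_ofPred_eq]
    simp only [Finset.mem_singleton, forall_eq]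
    rw [evalAt_X_one_sub, sub_eq_zero]
    rfl
  · intro Y hY hYX
    obtain ⟨q, hq, h⟩ := hY.exists_ne_zero (X := solutions f) (fun x => evalRingHom (x 0))
      (exists_evalAt_eq _ (fun c => ⟨C c, fun x _ => by simp⟩) fun i n => by
        obtain ⟨q, hq⟩ := exists_iterate_deriv_eq_eval f n
        exact ⟨q, fun x hx => by rw [Subsingleton.elim i 0]; exact hq _ hx⟩)
    rcases h with h | h
    · exact Or.inl ((finite_eval_eq_zero hq).subset fun x hx => h x (hYX hx) hx)
    · exact Or.inr ((finite_eval_eq_zero hq).subset fun x hx => h x hx.1 hx.2)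

lemma constants_eq_solutions : constants U = solutions (0 : U[X]) := by
  ext x
  simp [constants, solutions]

end StronglyMinimal

/-! ### From the absence of new constants to orthogonality. -/

section Correspondence

lemma evalEval_eq_sum {R : Type*} [CommRing R] (G : R[X][X]) (x y : R) {n : ℕ} (hn : G.natDegree < n) :
    G.evalEval x y = ∑ j ∈ Finset.range n, (G.coeff j).eval x * y ^ j := by
  rw [evalEval, eval_eq_sum_range' hn, eval_finsetSum]
  simp

lemma finite_of_finite_fibers {α β : Type*} {S : Set α} (φ : α → β) {B : Set β} (hB : B.Finite)
    (hf : ∀ b ∈ B, {s ∈ S | φ s = b}.Finite) : {s ∈ S | φ s ∈ B}.Finite :=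
  (hB.biUnion hf).subset fun _ hs => Set.mem_biUnion hs.2 ⟨hs.1, rfl⟩

variable {U : Type*} [Field U] [Differential U]

lemma deriv_evalEval (f : U[X]) (G : U[X][X]) {x y : U} (hx : x′ = f.eval x) (hy : y′ = 0) {n : ℕ}
    (hn : G.natDegree < n) :
    (G.evalEval x y)′ = ∑ j ∈ Finset.range n, (totalDeriv f (G.coeff j)).eval x * y ^ j := by
  rw [evalEval_eq_sum G x y hn, map_sum]
  refine Finset.sum_congr rfl fun j _ => ?_
  rw [Derivation.leibniz, Derivation.leibniz_pow, hy, deriv_eval f _ hx]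
  simp [mul_comm]

/-- If `U(x)`, with `x' = f(x)`, has no new constants, then every algebraic relation between
solutions of `z' = f(z)` and constants with finite fibers is finite. -/
theorem finite_of_evalEval_eq_zero {k : Type*} [Field k] [Algebra k U]
    (f : U[X]) (hconst : ∀ g h : U[X], h ≠ 0 → g * totalDeriv f h = h * totalDeriv f g →
      ∃ c : k, g = C (algebraMap k U c) * h) {S : Set (U × U)}
    (hS : ∀ p ∈ S, p.1′ = f.eval p.1 ∧ p.2′ = 0) (hfst : ∀ x, {p ∈ S | p.1 = x}.Finite)
    (hsnd : ∀ y, {p ∈ S | p.2 = y}.Finite) {G : U[X][X]} (hG : G ≠ 0)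
    (hGS : ∀ p ∈ S, G.evalEval p.1 p.2 = 0) : S.Finite := by
  induction hn : G.natDegree using Nat.strong_induction_on generalizing G with
  | _ n ih =>
    have hlead : G.coeff n ≠ 0 := by rw [← hn]; exact leadingCoeff_ne_zero.2 hG
    -- Up to sign a Wronskian of `G` and its leading coefficient: the terms in `y ^ n` cancel, and
    -- `H` still vanishes on `S` because `y' = 0`.
    set H : U[X][X] := ∑ j ∈ Finset.range n, monomial j
      (G.coeff n * totalDeriv f (G.coeff j) - G.coeff j * totalDeriv f (G.coeff n)) with hH
    have hHcoeff : ∀ j, H.coeff j = if j < n then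
        G.coeff n * totalDeriv f (G.coeff j) - G.coeff j * totalDeriv f (G.coeff n) else 0 := by
      intro j
      simp only [hH, finsetSum_coeff, coeff_monomial, Finset.sum_ite_eq', Finset.mem_range]
    by_cases hH0 : H = 0
    -- If `H = 0`, all ratios of coefficients are constants, so `G` factors as `gₙ(x) B(y)` and `S`
    -- lies over finitely many `x` or `y`.
    · have hc : ∀ j, ∃ c : k, G.coeff j = C (algebraMap k U c) * G.coeff n := by
        intro j
        rcases lt_trichotomy j n with hj | rfl | hj
        · refine hconst _ _ hlead ?_
          have := hHcoeff j
          rw [hH0, coeff_zero, if_pos hj] at this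
          linear_combination this
        · exact ⟨1, by simp⟩
        · exact ⟨0, by rw [coeff_eq_zero_of_natDegree_lt (by omega)]; simp⟩
      choose c hc using hc
      set B : U[X] := ∑ j ∈ Finset.range (n + 1), monomial j (algebraMap k U (c j)) with hB
      have hB0 : B ≠ 0 := by
        intro h
        have h1 := congrArg (fun p => coeff p n) h
        simp only [hB, finsetSum_coeff, coeff_monomial, Finset.sum_ite_eq', Finset.mem_range,
          Nat.lt_succ_self, if_true, coeff_zero] at h1
        have h2 := hc n
        rw [h1, C_0, zero_mul] at h2
        exact hlead h2
      have hfac : ∀ p ∈ S, (G.coeff n).eval p.1 * B.eval p.2 = 0 := by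
        intro p hp
        rw [← hGS p hp, evalEval_eq_sum G _ _ (n := n + 1) (by omega), hB, eval_finsetSum,
          Finset.mul_sum]
        refine Finset.sum_congr rfl fun j _ => ?_
        rw [hc j, eval_mul, eval_C, eval_monomial]
        ring
      have hroot : ∀ {r : U[X]}, r ≠ 0 → {x | r.eval x = 0}.Finite := fun {r} hr =>
        (r.rootSet_finite U).subset fun x hx => (mem_rootSet).2 ⟨hr, by simpa using hx⟩
      refine ((finite_of_finite_fibers Prod.fst (hroot hlead) fun x _ => hfst x).union
        (finite_of_finite_fibers Prod.snd (hroot hB0) fun y _ => hsnd y)).subset fun p hp => ?_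
      rcases mul_eq_zero.1 (hfac p hp) with h | h
      · exact Or.inl ⟨hp, h⟩
      · exact Or.inr ⟨hp, h⟩
    · have hHn : ∀ j, n ≤ j → H.coeff j = 0 := fun j hj => by rw [hHcoeff, if_neg (by omega)]
      have hdeg : H.natDegree < n := by
        by_contra hlt
        exact hH0 (leadingCoeff_eq_zero.1 (hHn _ (not_lt.1 hlt)))
      refine ih H.natDegree hdeg hH0 (fun p hp => ?_) rfl
      obtain ⟨hx, hy⟩ := hS p hp
      have e1 := deriv_evalEval f G hx hy (n := n + 1) (by omega)
      have e2 := evalEval_eq_sum G p.1 p.2 (n := n + 1) (by omega)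
      rw [hGS p hp, Finset.sum_range_succ] at e1 e2
      rw [map_zero] at e1
      have e3 : H.evalEval p.1 p.2 = (G.coeff n).eval p.1 *
          ∑ j ∈ Finset.range n, (totalDeriv f (G.coeff j)).eval p.1 * p.2 ^ j -
          (totalDeriv f (G.coeff n)).eval p.1 *
          ∑ j ∈ Finset.range n, (G.coeff j).eval p.1 * p.2 ^ j := by
        rw [evalEval_eq_sum H p.1 p.2 hdeg, Finset.mul_sum, Finset.mul_sum,
          ← Finset.sum_sub_distrib]
        refine Finset.sum_congr rfl fun j hj => ?_
        rw [hHcoeff, if_pos (Finset.mem_range.1 hj), eval_sub, eval_mul, eval_mul]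
        ring
      rw [e3]
      linear_combination (totalDeriv f (G.coeff n)).eval p.1 * e2 - (G.coeff n).eval p.1 * e1

/-- If `U(x)`, with `x' = f(x)`, has no new constants, then the equation `z' = f(z)` is orthogonal
to the constants. -/
theorem areOrthogonal_solutions_constants (hU : IsDifferentiallyClosed U)
    {k : Type*} [Field k] [Algebra k U]
    (f : U[X]) (hconst : ∀ g h : U[X], h ≠ 0 → g * totalDeriv f h = h * totalDeriv f g →
      ∃ c : k, g = C (algebraMap k U c) * h) :
    AreOrthogonal (solutions f) (constants U) := by
  have hconstants : IsStronglyMinimal (constants U) := by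
    rw [constants_eq_solutions]
    exact isStronglyMinimal_solutions hU 0
  refine ⟨isStronglyMinimal_solutions hU f, hconstants, ?_⟩
  rintro ⟨R, hR, hinf, hsub, hfst, hsnd⟩
  set X : Set (Fin 1 ⊕ Fin 1 → U) := {r | (r (Sum.inl 0))′ = f.eval (r (Sum.inl 0)) ∧
    (r (Sum.inr 0))′ = 0} with hX
  have hRX : ∀ r ∈ R, r ∈ X := fun r hr => ⟨(hsub r hr).1, (hsub r hr).2⟩
  obtain ⟨G, hG, h⟩ := hR.exists_ne_zero (X := X)
    (fun r => evalEvalRingHom (r (Sum.inl 0)) (r (Sum.inr 0)))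
    (exists_evalAt_eq _ (fun c => ⟨C (C c), fun x _ => by simp⟩) fun i n => by
      rcases i with i | i
      · obtain ⟨q, hq⟩ := exists_iterate_deriv_eq_eval f n
        refine ⟨C q, fun x hx => ?_⟩
        rw [Subsingleton.elim i 0, coe_evalEvalRingHom, evalEval_C]
        exact hq _ hx.1
      · obtain ⟨q, hq⟩ := exists_iterate_deriv_eq_eval (0 : U[X]) n
        refine ⟨q.map C, fun x hx => ?_⟩
        rw [Subsingleton.elim i 0, coe_evalEvalRingHom, evalEval_map_C]
        exact hq _ (by rw [hx.2, eval_zero]))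
  simp only [coe_evalEvalRingHom] at h
  have hfst' : ∀ x : U, {r ∈ R | r (Sum.inl 0) = x}.Finite := by
    intro x
    by_cases hx : (fun _ : Fin 1 => x) ∈ solutions f
    · refine (hfst _ hx).subset fun r hr => ⟨hr.1, funext fun i => ?_⟩
      rw [Subsingleton.elim i 0]
      exact hr.2
    · convert Set.finite_empty
      refine Set.eq_empty_of_forall_notMem fun r hr => hx ?_
      have := (hRX r hr.1).1
      rwa [hr.2] at this
  have hsnd' : ∀ y : U, {r ∈ R | r (Sum.inr 0) = y}.Finite := by
    intro y
    by_cases hy : (fun _ : Fin 1 => y) ∈ constants U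
    · refine (hsnd _ hy).subset fun r hr => ⟨hr.1, funext fun i => ?_⟩
      rw [Subsingleton.elim i 0]
      exact hr.2
    · convert Set.finite_empty
      refine Set.eq_empty_of_forall_notMem fun r hr => hy ?_
      have := (hRX r hr.1).2
      rwa [hr.2] at this
  have hpair : Function.Injective fun r : Fin 1 ⊕ Fin 1 → U => (r (Sum.inl 0), r (Sum.inr 0)) := by
    intro r s hrs
    rw [Prod.mk.injEq] at hrs
    funext i
    rcases i with i | i <;> rw [Subsingleton.elim i 0]
    exacts [hrs.1, hrs.2]
  rcases h with h | h
  · refine hinf (Set.Finite.of_finite_image (finite_of_evalEval_eq_zero f hconst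
      (S := (fun r : Fin 1 ⊕ Fin 1 → U => (r (Sum.inl 0), r (Sum.inr 0))) '' R)
      ?_ ?_ ?_ hG ?_) hpair.injOn)
    · rintro _ ⟨r, hr, rfl⟩
      exact hRX r hr
    · intro x
      refine ((hfst' x).image fun r => (r (Sum.inl 0), r (Sum.inr 0))).subset ?_
      rintro _ ⟨⟨r, hr, rfl⟩, hx⟩
      exact ⟨r, ⟨hr, hx⟩, rfl⟩
    · intro y
      refine ((hsnd' y).image fun r => (r (Sum.inl 0), r (Sum.inr 0))).subset ?_
      rintro _ ⟨⟨r, hr, rfl⟩, hy⟩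
      exact ⟨r, ⟨hr, hy⟩, rfl⟩
    · rintro _ ⟨r, hr, rfl⟩
      exact h r (hRX r hr) hr
  -- Here `R` contains every pair in `X` off `G = 0`, so its fibre over a constant `y` with `G(·, y)
  -- ≠ 0` is infinite.
  · obtain ⟨y, hy, hy'⟩ : ∃ y ∈ constants U, G.eval (C (y 0)) ≠ 0 := by
      by_contra! H
      refine hconstants.2.1 (Set.Finite.of_finite_image (f := fun y : Fin 1 → U => C (y 0))
        ((G.rootSet_finite U[X]).subset ?_) fun x _ y _ hxy => funext fun i => by
          rw [Subsingleton.elim i 0]; exact C_injective hxy)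
      rintro _ ⟨y, hy, rfl⟩
      rw [mem_rootSet]
      exact ⟨hG, by simpa using H y hy⟩
    have hinf' := (infinite_solutions hU f).sdiff (finite_eval_eq_zero hy')
    refine hinf' (Set.Finite.of_finite_image (f := fun x : Fin 1 → U => Sum.elim x y)
      ((hsnd y hy).subset ?_) fun x _ x' _ hxx => funext fun i => congrFun hxx (Sum.inl i))
    rintro _ ⟨x, ⟨hx, hx'⟩, rfl⟩
    refine ⟨?_, rfl⟩
    by_contra hn
    exact hx' (h (Sum.elim x y) ⟨hx, hy⟩ hn)

end Correspondence

/-! ### Roots of a cubic with generic constant term. -/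

section Cubic

variable {F L : Type*} [Field F] [Field L] [Algebra F L]

lemma isAlgebraic_eval {P : L[X]} (hP : ∀ i, IsAlgebraic F (P.coeff i)) {x : L}
    (hx : IsAlgebraic F x) : IsAlgebraic F (P.eval x) := by
  rw [eval_eq_sum_range]
  exact Subalgebra.sum_mem (Subalgebra.algebraicClosure F L) fun i _ => (hP i).mul (hx.pow i)

/-- If the ratio `(a₁ - a₃) / (a₂ - a₃)` for the roots of a cubic polynomial `P + c` is rational,
then `c` is algebraic over the field of the coefficients of `P`. -/
lemma isAlgebraic_of_sub_eq_smul_sub [CharZero F] {P : L[X]} (hP : ∀ i, IsAlgebraic F (P.coeff i))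
    {c α a₁ a₂ a₃ : L} (hα : α ≠ 0)
    (hroots : P + C c = C α * ((X - C a₁) * (X - C a₂) * (X - C a₃))) {s : ℚ}
    (hs : a₁ - a₃ = (algebraMap F L s) * (a₂ - a₃)) : IsAlgebraic F c := by
  have hcubic : C α * ((X - C a₁) * (X - C a₂) * (X - C a₃)) = C α * X ^ 3 +
      C (-(α * (a₁ + a₂ + a₃))) * X ^ 2 + C (α * (a₁ * a₂ + a₁ * a₃ + a₂ * a₃)) * X +
      C (-(α * a₁ * a₂ * a₃)) := by
    simp only [C_mul, C_add, C_neg]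
    ring
  have hcoeff : ∀ i, i ≠ 0 → IsAlgebraic F ((P + C c).coeff i) := fun i hi => by
    rw [coeff_add, coeff_C, if_neg hi, add_zero]
    exact hP i
  rw [hroots, hcubic] at hcoeff
  have h3 := hcoeff 3 (by norm_num)
  have h2 := hcoeff 2 (by norm_num)
  have h1 := hcoeff 1 (by norm_num)
  simp only [coeff_add, coeff_C_mul, coeff_X_pow, coeff_X, coeff_C] at h3 h2 h1
  norm_num at h3 h2 h1
  have : CharZero L := charZero_of_injective_algebraMap (algebraMap F L).injective
  rw [map_ratCast] at hs
  have hα' : α⁻¹ ∈ algebraicClosure F L := inv_mem (mem_algebraicClosure_iff.2 h3)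
  have he₁ : a₁ + a₂ + a₃ ∈ algebraicClosure F L := by
    convert mul_mem hα' (neg_mem (mem_algebraicClosure_iff.2 h2)) using 1
    rw [neg_neg]
    field_simp
  have he₂ : a₁ * a₂ + a₁ * a₃ + a₂ * a₃ ∈ algebraicClosure F L := by
    convert mul_mem hα' (mem_algebraicClosure_iff.2 h1) using 1
    field_simp
  have hQ : ∀ q : ℚ, (q : L) ∈ algebraicClosure F L := fun q =>
    mem_algebraicClosure_iff.2 (by
      rw [← map_ratCast (algebraMap F L)]
      exact isAlgebraic_algebraMap _)
  have hs0 : (s : L) ^ 2 - s + 1 ≠ 0 := by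
    have : s ^ 2 - s + 1 ≠ 0 := by nlinarith [sq_nonneg (2 * s - 1)]
    exact_mod_cast this
  have ht : a₂ - a₃ ∈ algebraicClosure F L := by
    refine mem_algebraicClosure_iff.2 (IsAlgebraic.of_pow (n := 2) two_pos ?_)
    rw [← mem_algebraicClosure_iff]
    -- The expression `e₁² - 3e₂` is translation invariant and does not involve `c`; on the roots
    -- `st, t, 0` it equals `(s² - s + 1)t²`.
    have e : (a₂ - a₃) ^ 2 = ((a₁ + a₂ + a₃) ^ 2 - (3 : ℚ) * (a₁ * a₂ + a₁ * a₃ + a₂ * a₃)) *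
        ((s ^ 2 - s + 1 : ℚ) : L)⁻¹ := by
      push_cast
      rw [eq_mul_inv_iff_mul_eq₀ hs0, sub_eq_iff_eq_add.1 hs]
      ring
    rw [e]
    exact mul_mem (sub_mem (pow_mem he₁ 2) (mul_mem (hQ _) he₂)) (inv_mem (hQ _))
  have ha₃ : a₃ ∈ algebraicClosure F L := by
    have e : a₃ = ((a₁ + a₂ + a₃) - (s + 1 : ℚ) * (a₂ - a₃)) * ((3 : ℚ) : L)⁻¹ := by
      push_cast
      rw [eq_mul_inv_iff_mul_eq₀ three_ne_zero, sub_eq_iff_eq_add.1 hs]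
      ring
    rw [e]
    exact mul_mem (sub_mem he₁ (mul_mem (hQ _) ht)) (inv_mem (hQ _))
  have hc : c = -P.eval a₃ := by
    have e := congrArg (eval a₃) hroots
    simp only [eval_add, eval_C, eval_mul, eval_sub, eval_X, sub_self, mul_zero] at e
    linear_combination e
  rw [hc]
  exact (isAlgebraic_eval hP (mem_algebraicClosure_iff.1 ha₃)).neg

lemma exists_eq_C_mul_of_natDegree_eq_three [IsAlgClosed L] {f : L[X]} (hf : f.natDegree = 3) :
    ∃ α a₁ a₂ a₃ : L, α ≠ 0 ∧ f = C α * ((X - C a₁) * (X - C a₂) * (X - C a₃)) := by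
  have hcard := IsAlgClosed.card_roots_eq_natDegree (p := f)
  rw [hf, Multiset.card_eq_three] at hcard
  obtain ⟨a₁, a₂, a₃, h⟩ := hcard
  refine ⟨f.leadingCoeff, a₁, a₂, a₃, leadingCoeff_ne_zero.2 (by rintro rfl; simp at hf), ?_⟩
  conv_lhs => rw [(IsAlgClosed.splits f).eq_prod_roots, h]
  simp [mul_assoc]

end Cubic

end DiffField

open Polynomial in
theorem corollary7 {U : Type*} [Field U] [Differential U] [Algebra ℂ U]
    (hclosed : DiffField.IsDifferentiallyClosed U)
    (hconst : ∀ x : U, Differential.deriv x = 0 ↔ x ∈ Set.range (algebraMap ℂ U))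
    (P : Polynomial ℂ) (hP : P.natDegree = 3)
    (c : ℂ) (hc : Transcendental (IntermediateField.adjoin ℚ (Set.range P.coeff)) c) :
    DiffField.AreOrthogonal
      (DiffField.solutions ((P + Polynomial.C c).map (algebraMap ℂ U)))
      (DiffField.constants U) := by
  have hcoeff : ∀ i, IsAlgebraic (IntermediateField.adjoin ℚ (Set.range P.coeff)) (P.coeff i) :=
    fun i => isAlgebraic_algebraMap (A := ℂ) (⟨P.coeff i,
      IntermediateField.subset_adjoin ℚ _ ⟨i, rfl⟩⟩ :
        IntermediateField.adjoin ℚ (Set.range P.coeff))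
  obtain ⟨α, a₁, a₂, a₃, hα, hroots⟩ := DiffField.exists_eq_C_mul_of_natDegree_eq_three
    (f := P + C c) (by rw [natDegree_add_C, hP])
  have key : ∀ {b₁ b₂ b₃ : ℂ},
      (X - C a₁) * (X - C a₂) * (X - C a₃) = (X - C b₁) * (X - C b₂) * (X - C b₃) →
      ∀ s : ℚ, b₁ - b₃ ≠ s * (b₂ - b₃) := fun {b₁ b₂ b₃} hb s hs =>
    hc (DiffField.isAlgebraic_of_sub_eq_smul_sub hcoeff hα (hb ▸ hroots) (s := s)
      (by rw [map_ratCast]; exact hs))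
  -- The ratio `s = 0` corresponds to a double root.
  have h12 : a₁ - a₂ ≠ 0 := by simpa using key (b₁ := a₁) (b₂ := a₃) (b₃ := a₂) (by ring) 0
  have h13 : a₁ - a₃ ≠ 0 := by simpa using key (b₁ := a₁) (b₂ := a₂) (b₃ := a₃) rfl 0
  have hd₁ : (derivative (P + C c)).eval a₁ = α * ((a₁ - a₂) * (a₁ - a₃)) := by
    rw [hroots]
    simp [derivative_mul]
  have hd₂ : (derivative (P + C c)).eval a₂ = α * ((a₂ - a₁) * (a₂ - a₃)) := by
    rw [hroots]
    simp [derivative_mul]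
  refine DiffField.areOrthogonal_solutions_constants (k := ℂ) hclosed _ fun g h hh hgh =>
    DiffField.exists_eq_C_mul_of_incommensurable hconst (fun ρ => ?_) (a := a₁) (b := a₂)
      (by rw [hroots]; simp) (by rw [hroots]; simp) ?_ (fun n hn m e => ?_) hh hgh
  · obtain ⟨u, hu, hu0⟩ := hclosed.exists_solution (C (-algebraMap ℂ U ρ) * X) X_ne_zero
    exact ⟨u, by simpa using hu0, by rw [hu, Algebra.smul_def]; simp⟩
  · rw [hd₁]
    exact mul_ne_zero hα (mul_ne_zero h12 h13)
  -- Cancelling `α (a₁ - a₂)` in `n f'(a₂) = m f'(a₁)` leaves `a₂ - a₃ = -(m / n)(a₁ - a₃)`.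
  · refine key (b₁ := a₂) (b₂ := a₁) (b₃ := a₃) (by ring) (-(m : ℚ) / n) ?_
    have hn' : (n : ℂ) ≠ 0 := Nat.cast_ne_zero.2 hn
    rw [hd₁, hd₂] at e
    push_cast
    rw [div_mul_eq_mul_div, eq_div_iff hn']
    refine mul_left_cancel₀ (mul_ne_zero hα h12) ?_
    linear_combination -e
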